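/- Theorem (Rationality of Poincaré Series of Divisors on Graphs). Let $G$ be a finite connected multigraph (loops and multiple edges are allowed) with vertex set $V(G)$ and edge set $E(G)$. A divisor on $G$ is an element $D=\sum_{u\in V(G)}a_u(u)$ of the free abelian group on $V(G)$; its degree is $\sum_u a_u$, and it is effective if every $a_u\ge 0$. The principal divisor of a function $\varphi:V(G)\to\mathbb{Z}$ is $\mathrm{div}(\varphi)=\sum_u\big(\sum_{e=(u,v)\in E(G)}(\varphi(u)-\varphi(v))\big)(u)$, and two divisors are linearly equivalent if their difference is principal. Write $|D|$ for the set of effective divisors linearly equivalent to $D$. The rank $r_G(D)$ is $-1$ if $|D|=\emptyset$, and otherwise it is the maximum integer $r$ such that $|D-E|\neq\emptyset$ for every effective divisor $E$ of degree $r$. Let $k\ge 0$, let $D_1,\dots,D_k$ be divisors on $G$, and let $\mathbb{N}$ be the set of non-negative integers. Then the Poincaré series $$P_{G,D_1,\dots,D_k}(z_1,\dots,z_k)=\sum_{(n_1,\dots,n_k)\in\mathbb{N}^k}\big(r_G(n_1D_1+\dots+n_kD_k)+1\big)\,z_1^{n_1}\cdots z_k^{n_k}$$ is rational. More precisely, there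 are polynomials $f,g\in\mathbb{Z}[z_1,\dots,z_k]$ with $g\neq 0$ such that $g\cdot P_{G,D_1,\dots,D_k}=f$ as formal power series, and such that at every $z\in\mathbb{C}^k$ where the series $P_{G,D_1,\dots,D_k}(z)$ is absolutely convergent, $g(z)\neq 0$ and the sum of the series is $f(z)/g(z)$. -/

import Mathlib

open scoped Graph

namespace Graph

variable {α β : Type*}

/-- A multigraph is connected if it has a vertex and any two of its vertices are joined by a
finite chain of successively adjacent vertices. -/
def IsConnected (G : Graph α β) : Prop :=
  V(G).Nonempty ∧ ∀ u ∈ V(G), ∀ v ∈ V(G), Relation.ReflTransGen G.Adj u v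

/-- Divisors on a multigraph with finite vertex set: the free abelian group on the vertices, a
divisor `∑ a_u (u)` being given by its coefficients `u ↦ a_u`. -/
abbrev Divisor (G : Graph α β) : Type _ := V(G) → ℤ

namespace Divisor

variable {G : Graph α β}

/-- The degree of a divisor is the sum of its coefficients. -/
def degree [Fintype V(G)] (D : Divisor G) : ℤ := ∑ u, D u

/-- A divisor is effective if all its coefficients are non-negative. -/
def IsEffective (D : Divisor G) : Prop := ∀ u, 0 ≤ D u

open Classical in
/-- The principal divisor of an integer-valued function `f` on the vertices: its coefficient at `u`
is the sum of `f u - f v` over all edges `e = (u, v)`, with multiplicity (a loop at `u`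
contributes `f u - f u = 0`). -/
noncomputable def principal [Fintype V(G)] [Fintype E(G)] (f : V(G) → ℤ) : Divisor G :=
  fun u => ∑ e : E(G), ∑ v : V(G), if G.IsLink e u v then f u - f v else 0

/-- Two divisors are linearly equivalent if their difference is principal. -/
def LinEquiv [Fintype V(G)] [Fintype E(G)] (D D' : Divisor G) : Prop :=
  ∃ f : V(G) → ℤ, D - D' = principal f

/-- The linear system `|D|`: all effective divisors linearly equivalent to `D`. -/
def linearSystem [Fintype V(G)] [Fintype E(G)] (D : Divisor G) : Set (Divisor G) :=
  {D' | IsEffective D' ∧ LinEquiv D' D}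

/-- The integers `r` such that `|D - E| ≠ ∅` for every effective divisor `E` of degree `r`. -/
def rankSet [Fintype V(G)] [Fintype E(G)] (D : Divisor G) : Set ℤ :=
  {r | ∀ E : Divisor G, IsEffective E → degree E = r → (linearSystem (D - E)).Nonempty}

open Classical in
/-- The rank of a divisor `D` is `-1` if `|D| = ∅`, and otherwise the maximum of `rankSet D` (this
maximum exists as soon as the graph has a vertex, see `isGreatest_rank`). -/
noncomputable def rank [Fintype V(G)] [Fintype E(G)] (D : Divisor G) : ℤ :=
  if linearSystem D = ∅ then -1 else sSup (rankSet D)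

theorem degree_principal [Fintype V(G)] [Fintype E(G)] (f : V(G) → ℤ) :
    degree (principal f : Divisor G) = 0 := by
  classical
  unfold degree principal
  rw [Finset.sum_comm]
  refine Finset.sum_eq_zero fun e _ => ?_
  have h : ∑ u : V(G), ∑ v : V(G), (if G.IsLink e u v then f u - f v else 0)
      = -∑ u : V(G), ∑ v : V(G), (if G.IsLink e u v then f u - f v else 0) := by
    conv_lhs => rw [Finset.sum_comm]
    simp only [← Finset.sum_neg_distrib]
    refine Finset.sum_congr rfl fun u _ => Finset.sum_congr rfl fun v _ => ?_
    rw [isLink_comm]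
    split_ifs <;> ring
  linarith

/-- The maximum in the definition of the rank is attained. -/
theorem isGreatest_rank [Fintype V(G)] [Fintype E(G)] (hV : V(G).Nonempty) (D : Divisor G)
    (hD : linearSystem D ≠ ∅) : IsGreatest (rankSet D) (rank D) := by
  classical
  obtain ⟨w, hw⟩ := hV
  have hne : (rankSet D).Nonempty := by
    refine ⟨-1, fun E hE hd => ?_⟩
    have : 0 ≤ degree E := Finset.sum_nonneg fun u _ => hE u
    omega
  have hzero : (0 : ℤ) ∈ rankSet D := by
    intro E hE hd
    have hE0 : E = 0 := by
      funext u
      exact (Finset.sum_eq_zero_iff_of_nonneg fun u _ => hE u).1 hd u (Finset.mem_univ u)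
    subst hE0
    simpa [Set.nonempty_iff_ne_empty] using hD
  have hbdd : BddAbove (rankSet D) := by
    refine ⟨max 0 (degree D), fun r hr => ?_⟩
    by_contra! hlt
    obtain ⟨h0, h1⟩ := max_lt_iff.1 hlt
    let E : Divisor G := Pi.single ⟨w, hw⟩ r
    have hEdeg : degree E = r := by simp [degree, E]
    have hEeff : IsEffective E := by
      intro u
      have : (0 : Divisor G) ≤ E := Pi.single_nonneg.2 h0.le
      exact this u
    obtain ⟨D', hD', f, hf⟩ := hr E hEeff hEdeg
    have h2 : 0 ≤ degree D' := Finset.sum_nonneg fun u _ => hD' u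
    have h3 : degree D' - (degree D - degree E) = 0 := by
      rw [← degree_principal f, ← hf]
      simp [degree, Finset.sum_sub_distrib]
    omega
  rw [rank, if_neg hD]
  exact ⟨Int.csSup_mem hne hbdd, fun r hr => le_csSup hbdd hr⟩

/-- The Poincaré series of a finite sequence of divisors, as a formal power series: the coefficient
of `z₁ ^ n₁ ⋯ z_k ^ n_k` is `r_G(n₁ D₁ + ⋯ + n_k D_k) + 1`. -/
noncomputable def poincareSeries [Fintype V(G)] [Fintype E(G)] {k : ℕ} (D : Fin k → Divisor G) :
    MvPowerSeries (Fin k) ℤ :=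
  fun n => rank (∑ i, n i • D i) + 1

/-- The value at `z ∈ ℂ ^ k` of the term of multidegree `n` of the Poincaré series. -/
noncomputable def poincareTerm [Fintype V(G)] [Fintype E(G)] {k : ℕ} (D : Fin k → Divisor G)
    (z : Fin k → ℂ) (n : Fin k →₀ ℕ) : ℂ :=
  ((MvPowerSeries.coeff n (poincareSeries D) : ℤ) : ℂ) * ∏ i, z i ^ n i

end Divisor

end Graph

/-! On a connected multigraph, divisors of degree zero are torsion modulo linear equivalence
(`exists_nsmul_eq_principal`). So `H = rank + 1` is periodic along every divisor of degree zero; it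
also vanishes in negative degree and equals the degree up to a constant in large degree
(`exists_rank_eq_degree_sub`).

These three properties give rationality by induction on the set of variables
(`orbitSeries_mem_rationalSeries`). Translation by an exponent `b` changes a generating series only
by series in fewer variables. If some nonzero `b` has degree zero, a multiple of it is a period.
Otherwise all the `D i` have degrees of one strict sign, and the affine or the zero range of `H`
applies.

Every denominator is a product of factors `1 - z ^ b` with `b ≠ 0` of non-negative degree. Then
infinitely many multiples of `b` carry a coefficient at least `1`, so absolute convergence at `z`
forces `‖z ^ b‖ < 1`, and no factor vanishes there. -/

namespace MvPowerSeries

/-! ### Evaluation of power series at complex points. -/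

section Evaluation

variable {σ : Type*} [Fintype σ]

theorem hasSum_X_mul {F : MvPowerSeries σ ℤ} {z : σ → ℂ} {S : ℂ} (i : σ)
    (h : HasSum (fun n : σ →₀ ℕ => ((coeff n F : ℤ) : ℂ) * ∏ j, z j ^ n j) S) :
    HasSum (fun n : σ →₀ ℕ => ((coeff n (X i * F) : ℤ) : ℂ) * ∏ j, z j ^ n j) (z i * S) := by
  classical
  have hinj : Function.Injective (fun n : σ →₀ ℕ => Finsupp.single i 1 + n) :=
    fun a b hab => add_left_cancel hab
  rw [← hinj.hasSum_iff]
  · refine (congrArg (HasSum · _) (funext fun n => ?_)).mpr (h.mul_left (z i))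
    rw [Function.comp_apply, X, coeff_add_monomial_mul, one_mul]
    have : ∏ j, z j ^ (Finsupp.single i 1 + n : σ →₀ ℕ) j = z i * ∏ j, z j ^ n j := by
      simp only [Finsupp.add_apply, pow_add, Finset.prod_mul_distrib]
      congr 1
      rw [Finset.prod_eq_single i] <;> simp +contextual [eq_comm]
    rw [this]
    ring
  · intro n hn
    rw [X, coeff_monomial_mul, if_neg]
    · simp
    · intro hle
      exact hn ⟨n - Finsupp.single i 1, add_tsub_cancel_of_le hle⟩

/-- Multiplying a convergent power series by a polynomial multiplies its sum by the value of the
polynomial. -/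
theorem hasSum_coe_mul {F : MvPowerSeries σ ℤ} {z : σ → ℂ} {S : ℂ}
    (h : HasSum (fun n : σ →₀ ℕ => ((coeff n F : ℤ) : ℂ) * ∏ j, z j ^ n j) S)
    (p : MvPolynomial σ ℤ) :
    HasSum (fun n : σ →₀ ℕ =>
      ((coeff n ((p : MvPowerSeries σ ℤ) * F) : ℤ) : ℂ) * ∏ j, z j ^ n j)
      (MvPolynomial.aeval z p * S) := by
  induction p using MvPolynomial.induction_on with
  | C a =>
    rw [MvPolynomial.aeval_C, MvPolynomial.coe_C]
    refine (congrArg (HasSum · _) (funext fun n => ?_)).mpr (h.mul_left (a : ℂ))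
    rw [coeff_C_mul]
    push_cast
    ring
  | add p q hp hq =>
    rw [map_add, add_mul]
    refine (congrArg (HasSum · _) (funext fun n => ?_)).mpr (hp.add hq)
    rw [MvPolynomial.coe_add, add_mul, map_add]
    push_cast
    ring
  | mul_X p i hp =>
    rw [map_mul, MvPolynomial.aeval_X, mul_comm _ (z i), mul_assoc]
    refine (congrArg (HasSum · _) (funext fun n => ?_)).mpr (hasSum_X_mul i hp)
    rw [MvPolynomial.coe_mul, MvPolynomial.coe_X, mul_comm (p : MvPowerSeries σ ℤ), mul_assoc]

theorem hasSum_coe (p : MvPolynomial σ ℤ) (z : σ → ℂ) :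
    HasSum (fun n : σ →₀ ℕ => ((coeff n (p : MvPowerSeries σ ℤ) : ℤ) : ℂ) * ∏ j, z j ^ n j)
      (MvPolynomial.aeval z p) := by
  classical
  have h1 : HasSum (fun n : σ →₀ ℕ =>
      ((coeff n (1 : MvPowerSeries σ ℤ) : ℤ) : ℂ) * ∏ j, z j ^ n j) 1 := by
    convert hasSum_ite_eq (0 : σ →₀ ℕ) (1 : ℂ) using 2 with n
    rw [coeff_one]
    split_ifs with hn <;> simp [hn]
  simpa using hasSum_coe_mul h1 p

end Evaluation

/-! ### Rationality of generating series of functions on an abelian group. -/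

section Rationality

variable {σ A : Type*} [AddCommGroup A]

/-- The submonoid of polynomials generated by the `1 - z ^ b` with `b ≠ 0` and
`deg (∑ b_i D_i) ≥ 0`. -/
noncomputable def denominators (deg : A →+ ℤ) (D : σ → A) : Submonoid (MvPolynomial σ ℤ) :=
  Submonoid.closure {p | ∃ b : σ →₀ ℕ, b ≠ 0 ∧ 0 ≤ deg (b.sum fun i m => m • D i) ∧
    p = 1 - MvPolynomial.monomial b 1}

theorem ne_zero_of_mem_denominators {deg : A →+ ℤ} {D : σ → A} {g : MvPolynomial σ ℤ}
    (hg : g ∈ denominators deg D) : g ≠ 0 := by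
  classical
  have : MvPolynomial.constantCoeff g = 1 := by
    induction hg using Submonoid.closure_induction with
    | mem p hp =>
      obtain ⟨b, hb, -, rfl⟩ := hp
      simp [MvPolynomial.constantCoeff_eq, MvPolynomial.coeff_monomial, hb]
    | one => simp
    | mul p q _ _ hp hq => simp [hp, hq]
  rintro rfl
  simp at this

/-- The power series that become polynomials after multiplication by an element of
`denominators deg D`. -/
noncomputable def rationalSeries (deg : A →+ ℤ) (D : σ → A) :
    Submodule (MvPolynomial σ ℤ) (MvPowerSeries σ ℤ) where
  carrier := {F | ∃ g ∈ denominators deg D, ∃ f : MvPolynomial σ ℤ,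
    (g : MvPowerSeries σ ℤ) * F = (f : MvPowerSeries σ ℤ)}
  add_mem' := by
    rintro F F' ⟨g, hg, f, hf⟩ ⟨g', hg', f', hf'⟩
    refine ⟨g * g', mul_mem hg hg', g' * f + g * f', ?_⟩
    push_cast
    rw [← hf, ← hf']
    ring
  zero_mem' := ⟨1, one_mem _, 0, by simp⟩
  smul_mem' := by
    rintro p F ⟨g, hg, f, hf⟩
    refine ⟨g, hg, p * f, ?_⟩
    rw [Algebra.smul_def, MvPolynomial.coe_mul, ← hf]
    change _ * ((p : MvPowerSeries σ ℤ) * F) = _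
    ring

theorem coe_mul_mem_rationalSeries {deg : A →+ ℤ} {D : σ → A} (p : MvPolynomial σ ℤ)
    {F : MvPowerSeries σ ℤ} (hF : F ∈ rationalSeries deg D) :
    (p : MvPowerSeries σ ℤ) * F ∈ rationalSeries deg D :=
  (rationalSeries deg D).smul_mem p hF

theorem monomial_mul_mem_rationalSeries {deg : A →+ ℤ} {D : σ → A} (b : σ →₀ ℕ)
    {F : MvPowerSeries σ ℤ} (hF : F ∈ rationalSeries deg D) :
    monomial b (1 : ℤ) * F ∈ rationalSeries deg D := by
  rw [← MvPolynomial.coe_monomial]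
  exact coe_mul_mem_rationalSeries _ hF

/-- The difference is `(1 - z ^ b) * F`, and `1 - z ^ b` is an allowed denominator. -/
theorem mem_rationalSeries_of_sub_mem {deg : A →+ ℤ} {D : σ → A} {b : σ →₀ ℕ} (hb : b ≠ 0)
    (hdeg : 0 ≤ deg (b.sum fun i m => m • D i)) {F : MvPowerSeries σ ℤ}
    (hF : F - monomial b 1 * F ∈ rationalSeries deg D) : F ∈ rationalSeries deg D := by
  obtain ⟨g, hg, f, hf⟩ := hF
  refine ⟨g * (1 - MvPolynomial.monomial b 1),
    mul_mem hg (Submonoid.subset_closure ⟨b, hb, hdeg, rfl⟩), f, ?_⟩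
  rw [← hf, MvPolynomial.coe_mul, ← MvPolynomial.coeToMvPowerSeries.ringHom_apply (φ := 1 - _),
    map_sub]
  simp only [MvPolynomial.coeToMvPowerSeries.ringHom_apply, MvPolynomial.coe_monomial,
    MvPolynomial.coe_one]
  ring

open Classical in
/-- The generating series of `n ↦ H (a + ∑ n_i D_i)`, restricted to the variables in `s`. -/
noncomputable def orbitSeries (H : A → ℤ) (D : σ → A) (s : Finset σ) (a : A) :
    MvPowerSeries σ ℤ :=
  fun n => if n.support ⊆ s then H (a + n.sum fun i m => m • D i) else 0

open Classical in
theorem coeff_orbitSeries (H : A → ℤ) (D : σ → A) (s : Finset σ) (a : A) (n : σ →₀ ℕ) :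
    coeff n (orbitSeries H D s a)
      = if n.support ⊆ s then H (a + n.sum fun i m => m • D i) else 0 := by
  rfl

theorem sum_smul_add (D : σ → A) (m n : σ →₀ ℕ) :
    ((m + n).sum fun i c => c • D i)
      = (m.sum fun i c => c • D i) + n.sum fun i c => c • D i := by
  classical
  exact Finsupp.sum_add_index' (by simp) (by simp [add_smul])

theorem sum_smul_single (D : σ → A) (i : σ) (m : ℕ) :
    ((Finsupp.single i m).sum fun i c => c • D i) = m • D i :=
  Finsupp.sum_single_index (zero_nsmul _)

theorem sum_smul_smul (D : σ → A) (N : ℕ) (n : σ →₀ ℕ) :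
    ((N • n).sum fun i c => c • D i) = N • n.sum fun i c => c • D i := by
  induction N with
  | zero => simp
  | succ N ih => rw [succ_nsmul, sum_smul_add, ih, succ_nsmul]

/-- Exponents split according to whether `n i` is zero or positive. -/
theorem orbitSeries_eq_add [DecidableEq σ] (H : A → ℤ) (D : σ → A) {s : Finset σ} {i : σ}
    (hi : i ∈ s) (a : A) :
    orbitSeries H D s a
      = orbitSeries H D (s.erase i) a + monomial (Finsupp.single i 1) 1
        * orbitSeries H D s (a + D i) := by
  classical
  ext n
  rw [map_add, coeff_monomial_mul]
  simp only [coeff_orbitSeries, Finset.subset_erase]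
  by_cases hn : n i = 0
  · rw [if_neg (c := Finsupp.single i 1 ≤ n)]
    · simp [hn]
    · simp [hn]
  · have hle : Finsupp.single i 1 ≤ n := by simpa [Nat.one_le_iff_ne_zero] using hn
    obtain ⟨m, rfl⟩ := exists_add_of_le hle
    have hs : (Finsupp.single i 1 + m).support ⊆ s ↔ m.support ⊆ s := by
      constructor
      · refine fun h j hj => h ?_
        simp only [Finsupp.mem_support_iff, Finsupp.add_apply] at hj ⊢
        omega
      · intro h
        refine Finsupp.support_add.trans (Finset.union_subset ?_ h)
        exact Finsupp.support_single_subset.trans (by simpa using hi)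
    simp only [if_pos hle, add_tsub_cancel_left, hs, sum_smul_add, sum_smul_single]
    simp [add_assoc]

/-- Translating the exponents by `b` changes the generating series only by series in fewer
variables. -/
theorem orbitSeries_sub_mem [DecidableEq σ] {H : A → ℤ} {deg : A →+ ℤ} {D : σ → A} {s : Finset σ}
    (ih : ∀ i ∈ s, ∀ a, orbitSeries H D (s.erase i) a ∈ rationalSeries deg D)
    (b : σ →₀ ℕ) (hb : b.support ⊆ s) (a : A) :
    orbitSeries H D s a
      - monomial b 1 * orbitSeries H D s (a + b.sum fun i m => m • D i)
      ∈ rationalSeries deg D := by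
  induction b using Finsupp.induction_linear generalizing a with
  | zero => simp
  | add b c hb' hc' =>
    have hsub : b.support ⊆ s ∧ c.support ⊆ s := by
      constructor <;> refine fun j hj => hb ?_ <;>
        simp only [Finsupp.mem_support_iff, Finsupp.add_apply] at hj ⊢ <;> omega
    have h := add_mem (hb' hsub.1 a) (monomial_mul_mem_rationalSeries b
      (hc' hsub.2 (a + b.sum fun i m => m • D i)))
    convert h using 1
    rw [mul_sub, ← mul_assoc, monomial_mul_monomial, one_mul, sum_smul_add, add_assoc]
    abel
  | single i m =>
    rcases eq_or_ne m 0 with rfl | hm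
    · simp
    have hi : i ∈ s := hb (by simp [hm])
    clear hb hm
    induction m generalizing a with
    | zero => simp
    | succ m hm =>
      have h := add_mem (hm a) (monomial_mul_mem_rationalSeries (Finsupp.single i m)
        (ih i hi (a + m • D i)))
      convert h using 1
      rw [sum_smul_single, sum_smul_single,
        orbitSeries_eq_add H D hi (a + m • D i), mul_add, ← mul_assoc, monomial_mul_monomial,
        one_mul, ← Finsupp.single_add, succ_nsmul, add_assoc]
      abel

theorem orbitSeries_mem_of_period [DecidableEq σ] {H : A → ℤ} {deg : A →+ ℤ} {D : σ → A}
    {s : Finset σ} (ih : ∀ i ∈ s, ∀ a, orbitSeries H D (s.erase i) a ∈ rationalSeries deg D)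
    {b : σ →₀ ℕ} (hb : b.support ⊆ s) (hb0 : b ≠ 0)
    (hdeg : 0 ≤ deg (b.sum fun i m => m • D i))
    (hper : ∀ x, H (x + b.sum fun i m => m • D i) = H x) (a : A) :
    orbitSeries H D s a ∈ rationalSeries deg D := by
  classical
  have h := orbitSeries_sub_mem ih b hb a
  have heq : orbitSeries H D s (a + b.sum fun i m => m • D i) = orbitSeries H D s a := by
    ext n
    rw [coeff_orbitSeries, coeff_orbitSeries, add_right_comm, hper]
  rw [heq] at h
  exact mem_rationalSeries_of_sub_mem hb0 hdeg h

theorem orbitSeries_empty_mem (H : A → ℤ) (deg : A →+ ℤ) (D : σ → A) (a : A) :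
    orbitSeries H D ∅ a ∈ rationalSeries deg D := by
  classical
  refine ⟨1, one_mem _, MvPolynomial.C (H a), ?_⟩
  rw [MvPolynomial.coe_one, one_mul, MvPolynomial.coe_C]
  ext n
  rw [coeff_orbitSeries, coeff_C]
  simp only [Finset.subset_empty, Finsupp.support_eq_empty]
  split_ifs with h
  · simp [h]
  · rfl

/-- Rationality when all the variables have positive degree. -/
theorem orbitSeries_mem_of_pos [DecidableEq σ] {H : A → ℤ} {deg : A →+ ℤ} {D : σ → A}
    {s : Finset σ} (ih : ∀ i ∈ s, ∀ a, orbitSeries H D (s.erase i) a ∈ rationalSeries deg D)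
    (hs : s.Nonempty) (hpos : ∀ i ∈ s, 0 < deg (D i)) {C γ : ℤ}
    (hH : ∀ x, C ≤ deg x → H x = deg x - γ) (a : A) :
    orbitSeries H D s a ∈ rationalSeries deg D := by
  classical
  -- For a constant function every variable is a period.
  have hone : ∀ t ⊆ s, orbitSeries (fun _ : A => (1 : ℤ)) D t 0 ∈ rationalSeries deg D := by
    intro t
    induction t using Finset.strongInduction with
    | H t iht =>
      intro hts
      rcases t.eq_empty_or_nonempty with rfl | ⟨i, hi⟩
      · exact orbitSeries_empty_mem _ _ _ _
      · have herase : ∀ j ∈ t, ∀ x, orbitSeries (fun _ : A => (1 : ℤ)) D (t.erase j) x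
            ∈ rationalSeries deg D := fun j hj x =>
          iht _ (Finset.erase_ssubset hj) ((Finset.erase_subset _ _).trans hts)
        refine orbitSeries_mem_of_period herase (b := Finsupp.single i 1) ?_ (by simp) ?_
          (fun _ => rfl) 0
        · exact Finsupp.support_single_subset.trans (by simpa using hi)
        · simpa using (hpos i (hts hi)).le
  obtain ⟨i, hi⟩ := hs
  have hlarge : ∀ x, C ≤ deg x → orbitSeries H D s x ∈ rationalSeries deg D := by
    intro x hx
    -- In the affine range, translation by `D i` adds the constant `deg (D i)` to every coefficient
    -- with support in `s`.
    have hstep : orbitSeries H D s (x + D i) = orbitSeries H D s x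
        + deg (D i) • orbitSeries (fun _ : A => (1 : ℤ)) D s 0 := by
      ext n
      rw [map_add, map_zsmul, coeff_orbitSeries, coeff_orbitSeries, coeff_orbitSeries]
      split_ifs with hn
      · have hnn : 0 ≤ deg (n.sum fun i m => m • D i) := by
          rw [Finsupp.sum, map_sum]
          refine Finset.sum_nonneg fun j hj => ?_
          rw [map_nsmul]
          exact nsmul_nonneg (hpos j (hn hj)).le _
        have hi' := hpos i hi
        rw [hH _ (by simp only [map_add]; omega), hH _ (by simp only [map_add]; omega)]
        simp only [map_add, smul_eq_mul]
        ring
      · simp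
    have h := orbitSeries_sub_mem ih (Finsupp.single i 1)
      (Finsupp.support_single_subset.trans (by simpa using hi)) x
    rw [sum_smul_single, one_nsmul, hstep, mul_add, ← sub_sub] at h
    have h1 := monomial_mul_mem_rationalSeries (Finsupp.single i 1)
      (zsmul_mem (hone s subset_rfl) (deg (D i)))
    refine mem_rationalSeries_of_sub_mem (b := Finsupp.single i 1) (by simp) ?_
      (by simpa using add_mem h h1)
    simpa using (hpos i hi).le
  -- Each translation by `D i` raises the degree by at least one, so this many reach the affine
  -- range.
  have h := orbitSeries_sub_mem ih (Finsupp.single i (C - deg a).toNat)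
    (Finsupp.support_single_subset.trans (by simpa using hi)) a
  rw [sum_smul_single] at h
  have h1 := monomial_mul_mem_rationalSeries (Finsupp.single i (C - deg a).toNat)
    (hlarge (a + (C - deg a).toNat • D i) ?_)
  · simpa using add_mem h h1
  · have h2 := Int.self_le_toNat (C - deg a)
    have h3 := hpos i hi
    rw [map_add, map_nsmul, nsmul_eq_mul]
    nlinarith [Int.natCast_nonneg (C - deg a).toNat]

/-- Rationality when all the variables have negative degree. -/
theorem orbitSeries_mem_of_neg [DecidableEq σ] {H : A → ℤ} {deg : A →+ ℤ} {D : σ → A}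
    {s : Finset σ} (ih : ∀ i ∈ s, ∀ a, orbitSeries H D (s.erase i) a ∈ rationalSeries deg D)
    (hs : s.Nonempty) (hneg : ∀ i ∈ s, deg (D i) < 0)
    (hH : ∀ x, deg x < 0 → H x = 0) (a : A) :
    orbitSeries H D s a ∈ rationalSeries deg D := by
  classical
  obtain ⟨i, hi⟩ := hs
  -- Each translation by `D i` lowers the degree by at least one, so `N` of them make it negative.
  set N := (deg a + 1).toNat with hN
  have h := orbitSeries_sub_mem ih (Finsupp.single i N)
    (Finsupp.support_single_subset.trans (by simpa using hi)) a
  rw [sum_smul_single] at h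
  have hzero : orbitSeries H D s (a + N • D i) = 0 := by
    ext n
    rw [coeff_orbitSeries, map_zero]
    split_ifs with hn
    swap
    · rfl
    apply hH
    have hnn : deg (n.sum fun i m => m • D i) ≤ 0 := by
      rw [Finsupp.sum, map_sum]
      refine Finset.sum_nonpos fun j hj => ?_
      rw [map_nsmul]
      exact nsmul_nonpos (hneg j (hn hj)).le _
    have h2 := Int.self_le_toNat (deg a + 1)
    have h3 := hneg i hi
    rw [map_add, map_add, map_nsmul, nsmul_eq_mul]
    nlinarith [Int.natCast_nonneg N]
  simpa [hzero] using h

/-- The generating series of an eventually linear function of the degree, invariant under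
multiples of the elements of degree zero, is rational. -/
theorem orbitSeries_mem_rationalSeries {H : A → ℤ} {deg : A →+ ℤ} (D : σ → A) {C γ : ℤ}
    (hzero : ∀ x, deg x < 0 → H x = 0) (hlin : ∀ x, C ≤ deg x → H x = deg x - γ)
    (htors : ∀ y, deg y = 0 → ∃ N : ℕ, N ≠ 0 ∧ ∀ x, H (x + N • y) = H x)
    (s : Finset σ) (a : A) : orbitSeries H D s a ∈ rationalSeries deg D := by
  classical
  induction s using Finset.strongInduction generalizing a with
  | H s iht =>
    have ih : ∀ i ∈ s, ∀ a, orbitSeries H D (s.erase i) a ∈ rationalSeries deg D :=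
      fun i hi a => iht _ (Finset.erase_ssubset hi) a
    rcases s.eq_empty_or_nonempty with rfl | hs
    · exact orbitSeries_empty_mem _ _ _ _
    by_cases hb : ∃ b : σ →₀ ℕ, b.support ⊆ s ∧ b ≠ 0 ∧ deg (b.sum fun i m => m • D i) = 0
    · obtain ⟨b, hbs, hb0, hbd⟩ := hb
      obtain ⟨N, hN, hper⟩ := htors _ hbd
      refine orbitSeries_mem_of_period ih (b := N • b)
        (Finsupp.support_smul.trans hbs) (smul_ne_zero hN hb0) ?_ ?_ a
      · rw [sum_smul_smul, map_nsmul, hbd, smul_zero]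
      · rwa [sum_smul_smul]
    push Not at hb
    have hne : ∀ i ∈ s, deg (D i) ≠ 0 := by
      intro i hi
      have := hb (Finsupp.single i 1)
        (Finsupp.support_single_subset.trans (by simpa using hi)) (by simp)
      simpa using this
    by_cases hpos : ∀ i ∈ s, 0 < deg (D i)
    · exact orbitSeries_mem_of_pos ih hs hpos hlin a
    by_cases hneg : ∀ i ∈ s, deg (D i) < 0
    · exact orbitSeries_mem_of_neg ih hs hneg hzero a
    push Not at hpos hneg
    obtain ⟨i, hi, hi'⟩ := hpos
    obtain ⟨j, hj, hj'⟩ := hneg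
    have hi0 : deg (D i) < 0 := lt_of_le_of_ne hi' (hne i hi)
    have hj0 : 0 < deg (D j) := lt_of_le_of_ne hj' (hne j hj).symm
    -- Variables of opposite signs would combine to a nonzero exponent of degree zero.
    refine absurd ?_ (hb (Finsupp.single i (deg (D j)).toNat
      + Finsupp.single j (-deg (D i)).toNat) ?_ ?_)
    · rw [sum_smul_add, sum_smul_single,
        sum_smul_single, map_add, map_nsmul, map_nsmul, nsmul_eq_mul,
        nsmul_eq_mul, Int.toNat_of_nonneg hj', Int.toNat_of_nonneg (by omega)]
      ring
    · refine Finsupp.support_add.trans (Finset.union_subset ?_ ?_) <;>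
        exact Finsupp.support_single_subset.trans (by simpa)
    · intro h
      have := DFunLike.congr_fun h i
      simp only [Finsupp.add_apply, Finsupp.single_eq_same, Finsupp.coe_zero, Pi.zero_apply]
        at this
      omega

end Rationality

end MvPowerSeries

/-! ### Linear equivalence and growth of the rank. -/

namespace Graph.Divisor

variable {α β : Type*} {G : Graph α β}

theorem isEffective_single [DecidableEq V(G)] (v : V(G)) {r : ℤ} (hr : 0 ≤ r) :
    IsEffective (Pi.single v r : Divisor G) :=
  fun u => (Pi.single_nonneg.2 hr : (0 : Divisor G) ≤ Pi.single v r) u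

theorem IsEffective.add {D D' : Divisor G} (h : IsEffective D) (h' : IsEffective D') :
    IsEffective (D + D') := fun u => add_nonneg (h u) (h' u)

variable [Fintype V(G)]

/-- The degree as a homomorphism. -/
def degreeHom : Divisor G →+ ℤ where
  toFun := degree
  map_zero' := by simp [degree]
  map_add' D D' := by simp [degree, Finset.sum_add_distrib]

theorem degreeHom_apply (D : Divisor G) : degreeHom D = degree D := rfl

theorem degree_add (D D' : Divisor G) : degree (D + D') = degree D + degree D' :=
  map_add degreeHom D D'

theorem degree_sub (D D' : Divisor G) : degree (D - D') = degree D - degree D' :=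
  map_sub degreeHom D D'

theorem degree_single [DecidableEq V(G)] (v : V(G)) (r : ℤ) :
    degree (Pi.single v r : Divisor G) = r := by
  simp [degree]

theorem IsEffective.degree_nonneg {D : Divisor G} (h : IsEffective D) : 0 ≤ degree D :=
  Finset.sum_nonneg fun u _ => h u

variable [Fintype E(G)]

/-- `principal` as a homomorphism. -/
noncomputable def principalHom : (V(G) → ℤ) →+ Divisor G where
  toFun := principal
  map_zero' := by ext; simp [principal]
  map_add' f f' := by
    ext u
    simp only [principal, Pi.add_apply, ← Finset.sum_add_distrib]
    refine Finset.sum_congr rfl fun e _ => Finset.sum_congr rfl fun v _ => ?_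
    split_ifs <;> ring

theorem linEquiv_iff {D D' : Divisor G} :
    LinEquiv D D' ↔ D - D' ∈ (principalHom (G := G)).range :=
  exists_congr fun _ => eq_comm

theorem LinEquiv.degree_eq {D D' : Divisor G} (h : LinEquiv D D') : degree D = degree D' := by
  obtain ⟨f, hf⟩ := h
  have := degree_principal (G := G) f
  rw [← hf, degree_sub] at this
  omega

theorem LinEquiv.symm {D D' : Divisor G} (h : LinEquiv D D') : LinEquiv D' D := by
  rw [linEquiv_iff] at *
  simpa using neg_mem h

theorem LinEquiv.trans {D D' D'' : Divisor G} (h : LinEquiv D D') (h' : LinEquiv D' D'') :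
    LinEquiv D D'' := by
  rw [linEquiv_iff] at *
  simpa using add_mem h h'

theorem LinEquiv.add_right {D D' : Divisor G} (h : LinEquiv D D') (F : Divisor G) :
    LinEquiv (D + F) (D' + F) := by
  rw [linEquiv_iff] at *
  simpa using h

theorem linearSystem_congr {D D' : Divisor G} (h : LinEquiv D D') :
    linearSystem D = linearSystem D' :=
  Set.ext fun _ => and_congr_right fun _ => ⟨fun h' => h'.trans h, fun h' => h'.trans h.symm⟩

theorem rank_congr {D D' : Divisor G} (h : LinEquiv D D') : rank D = rank D' := by
  have : rankSet D = rankSet D' := by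
    ext r
    refine forall_congr' fun E => ?_
    rw [sub_eq_add_neg, sub_eq_add_neg, linearSystem_congr (h.add_right (-E))]
  rw [rank, rank, this, linearSystem_congr h]

theorem linearSystem_add_nonempty {D E : Divisor G} (hE : IsEffective E)
    (h : (linearSystem D).Nonempty) : (linearSystem (D + E)).Nonempty := by
  obtain ⟨D', hD', hl⟩ := h
  exact ⟨D' + E, hD'.add hE, hl.add_right E⟩

theorem rank_eq_neg_one {D : Divisor G} (h : linearSystem D = ∅) : rank D = -1 := by
  rw [rank, if_pos h]

theorem rank_of_degree_neg {D : Divisor G} (h : degree D < 0) : rank D = -1 := by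
  refine rank_eq_neg_one (Set.eq_empty_iff_forall_notMem.2 fun D' hD' => ?_)
  have h1 := hD'.1.degree_nonneg
  rw [hD'.2.degree_eq] at h1
  omega

theorem zero_le_rank (hV : V(G).Nonempty) {D : Divisor G} (h : (linearSystem D).Nonempty) :
    0 ≤ rank D := by
  refine (isGreatest_rank hV D h.ne_empty).2 fun E hE hd => ?_
  have hE0 : E = 0 := by
    funext u
    exact (Finset.sum_eq_zero_iff_of_nonneg fun u _ => hE u).1 hd u (Finset.mem_univ u)
  rwa [hE0, sub_zero]

theorem neg_one_le_rank (hV : V(G).Nonempty) (D : Divisor G) : -1 ≤ rank D := by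
  rcases (linearSystem D).eq_empty_or_nonempty with h | h
  · exact (rank_eq_neg_one h).ge
  · linarith [zero_le_rank hV h]

theorem le_rank (hV : V(G).Nonempty) {D : Divisor G} {r : ℤ} (h : -1 ≤ r → r ∈ rankSet D) :
    r ≤ rank D := by
  classical
  rcases lt_or_ge r 0 with hr | hr
  · exact le_trans (by omega) (neg_one_le_rank hV D)
  obtain ⟨w, hw⟩ := hV
  have hE := isEffective_single (G := G) ⟨w, hw⟩ hr
  have hne := linearSystem_add_nonempty hE (h (by omega) _ hE (degree_single _ r))
  rw [sub_add_cancel] at hne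
  exact (isGreatest_rank ⟨w, hw⟩ D hne.ne_empty).2 (h (by omega))

/-- Removing `F + E` from `D + E` is the same as removing `F` from `D`. -/
theorem rank_add_le (hV : V(G).Nonempty) (D : Divisor G) {E : Divisor G} (hE : IsEffective E) :
    rank (D + E) ≤ rank D + degree E := by
  have hdeg := hE.degree_nonneg
  rcases (linearSystem (D + E)).eq_empty_or_nonempty with h | h
  · rw [rank_eq_neg_one h]
    linarith [neg_one_le_rank hV D]
  rw [← sub_le_iff_le_add]
  refine le_rank hV fun _ F hF hFd => ?_
  have := (isGreatest_rank hV _ h.ne_empty).1 (F + E) (hF.add hE) (by rw [degree_add]; omega)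
  rwa [add_sub_add_right_eq_sub] at this

theorem degree_sub_le_rank (hV : V(G).Nonempty) {C : ℤ}
    (hC : ∀ D : Divisor G, C ≤ degree D → (linearSystem D).Nonempty) (D : Divisor G) :
    degree D - C ≤ rank D :=
  le_rank hV fun _ E _ hEd => hC _ (by rw [degree_sub]; omega)

/-- For divisors of large degree, the rank is the degree up to a constant. -/
theorem exists_rank_eq_degree_sub (hV : V(G).Nonempty) {C : ℤ}
    (hC : ∀ D : Divisor G, C ≤ degree D → (linearSystem D).Nonempty) :
    ∃ C' γ : ℤ, ∀ D : Divisor G, C' ≤ degree D → rank D = degree D - γ := by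
  -- `degree - rank` is bounded above by `C` and cannot decrease when an effective divisor is added.
  -- Every `D` of large degree is equivalent to `D₀ + E` with `E` effective, so it also attains the
  -- maximum `γ`.
  obtain ⟨γ, ⟨D₀, hD₀⟩, hγ⟩ := Int.exists_greatest_of_bdd
    (P := fun m => ∃ D : Divisor G, degree D - rank D = m)
    ⟨C, by rintro _ ⟨D, rfl⟩; linarith [degree_sub_le_rank hV hC D]⟩ ⟨_, 0, rfl⟩
  refine ⟨C + degree D₀, γ, fun D hD => ?_⟩
  obtain ⟨E, hE, hl⟩ := hC (D - D₀) (by rw [degree_sub]; omega)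
  have hle : LinEquiv (D₀ + E) D := by
    simpa [add_comm] using hl.add_right D₀
  have h1 := rank_add_le hV D₀ hE
  have h2 := hγ _ ⟨D, rfl⟩
  have h3 := hle.degree_eq
  rw [rank_congr hle] at h1
  rw [degree_add] at h3
  omega

/-! ### Degree-zero divisors are torsion. -/

section Torsion

/-- The rational Laplacian of a multigraph. -/
noncomputable def laplacian (G : Graph α β) [Fintype V(G)] [Fintype E(G)] :
    (V(G) → ℚ) →ₗ[ℚ] (V(G) → ℚ) := by
  classical
  exact
  { toFun := fun f u => ∑ e : E(G), ∑ v : V(G), if G.IsLink e u v then f u - f v else 0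
    map_add' := fun f f' => by
      ext u
      simp only [Pi.add_apply, ← Finset.sum_add_distrib]
      refine Finset.sum_congr rfl fun e _ => Finset.sum_congr rfl fun v _ => ?_
      split_ifs <;> ring
    map_smul' := fun c f => by
      ext u
      simp only [Pi.smul_apply, smul_eq_mul, Finset.mul_sum, RingHom.id_apply]
      refine Finset.sum_congr rfl fun e _ => Finset.sum_congr rfl fun v _ => ?_
      split_ifs <;> ring }

open Classical in
theorem laplacian_apply (f : V(G) → ℚ) (u : V(G)) :
    laplacian G f u = ∑ e : E(G), ∑ v : V(G), if G.IsLink e u v then f u - f v else 0 := rfl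

theorem laplacian_intCast (f : V(G) → ℤ) (u : V(G)) :
    laplacian G (fun v => (f v : ℚ)) u = (principal f u : ℤ) := by
  classical
  rw [laplacian_apply, principal]
  push_cast
  refine Finset.sum_congr rfl fun e _ => Finset.sum_congr rfl fun v _ => ?_
  split_ifs <;> simp

theorem sum_laplacian (f : V(G) → ℚ) : ∑ u, laplacian G f u = 0 := by
  classical
  simp only [laplacian_apply]
  rw [Finset.sum_comm]
  refine Finset.sum_eq_zero fun e _ => ?_
  have h : ∑ u : V(G), ∑ v : V(G), (if G.IsLink e u v then f u - f v else 0)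
      = -∑ u : V(G), ∑ v : V(G), (if G.IsLink e u v then f u - f v else 0) := by
    conv_lhs => rw [Finset.sum_comm]
    simp only [← Finset.sum_neg_distrib]
    refine Finset.sum_congr rfl fun u _ => Finset.sum_congr rfl fun v _ => ?_
    rw [isLink_comm]
    split_ifs <;> ring
  linarith

/-- The maximum principle: a harmonic function on a connected multigraph is constant. -/
theorem eq_of_laplacian_eq_zero (hG : G.IsConnected) {f : V(G) → ℚ} (hf : laplacian G f = 0)
    (u v : V(G)) : f u = f v := by
  classical
  obtain ⟨m, hm⟩ : ∃ m, ∀ v, f v ≤ f m := by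
    have : Nonempty V(G) := hG.1.to_subtype
    exact Finite.exists_max f
  suffices h : ∀ v : α, Relation.ReflTransGen G.Adj m v → ∀ hv : v ∈ V(G), f ⟨v, hv⟩ = f m by
    rw [h u (hG.2 _ m.2 _ u.2) u.2, h v (hG.2 _ m.2 _ v.2) v.2]
  intro v hv
  induction hv with
  | refl => intro _; rfl
  | @tail b c _ hbc ih =>
    intro hc
    have hb := hbc.left_mem
    have hfb := ih hb
    obtain ⟨e, he⟩ := hbc
    have h0 := congrFun hf ⟨b, hb⟩
    rw [laplacian_apply, Pi.zero_apply] at h0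
    -- At a vertex where `f` is maximal, the Laplacian is a sum of non-negative terms; being zero,
    -- it forces each term to vanish.
    have hnn : ∀ e' : E(G), ∀ v : V(G),
        0 ≤ if G.IsLink e' b v then f ⟨b, hb⟩ - f v else 0 := by
      intro e' v
      split_ifs
      · rw [hfb]
        linarith [hm v]
      · exact le_rfl
    have h1 := (Finset.sum_eq_zero_iff_of_nonneg
      fun e' _ => Finset.sum_nonneg fun v _ => hnn e' v).1 h0 ⟨e, he.edge_mem⟩ (Finset.mem_univ _)
    have h2 := (Finset.sum_eq_zero_iff_of_nonneg
      fun v _ => hnn _ v).1 h1 ⟨c, hc⟩ (Finset.mem_univ _)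
    rw [if_pos he] at h2
    linarith

/-- Dimension count: the kernel is at most the line of constants, so the image fills the hyperplane
of sum zero that contains it. -/
theorem exists_laplacian_eq (hG : G.IsConnected) {x : V(G) → ℚ} (hx : ∑ u, x u = 0) :
    ∃ f, laplacian G f = x := by
  classical
  obtain ⟨w, hw⟩ := hG.1
  let s : (V(G) → ℚ) →ₗ[ℚ] ℚ := ∑ u, LinearMap.proj u
  have hs : ∀ y, s y = ∑ u, y u := fun y => by simp [s]
  have hle : LinearMap.range (laplacian G) ≤ LinearMap.ker s := by
    rintro _ ⟨f, rfl⟩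
    rw [LinearMap.mem_ker, hs, sum_laplacian]
  have hker : LinearMap.ker (laplacian G) ≤ Submodule.span ℚ {fun _ => (1 : ℚ)} := by
    intro f hf
    refine Submodule.mem_span_singleton.2 ⟨f ⟨w, hw⟩, ?_⟩
    ext v
    simpa using eq_of_laplacian_eq_zero hG hf ⟨w, hw⟩ v
  have h1 := (Submodule.finrank_mono hker).trans_eq (finrank_span_singleton fun h => one_ne_zero (congrFun h ⟨w, hw⟩))
  have h2 := LinearMap.finrank_range_add_finrank_ker (laplacian G)
  have h3 := LinearMap.finrank_range_add_finrank_ker s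
  have h4 : Module.finrank ℚ (LinearMap.range s) = 1 := by
    rw [LinearMap.range_eq_top.2, finrank_top, Module.finrank_self]
    exact fun c => ⟨Pi.single ⟨w, hw⟩ c, by simp [hs]⟩
  have heq := Submodule.eq_of_le_of_finrank_le hle (by omega)
  have : x ∈ LinearMap.ker s := by rw [LinearMap.mem_ker, hs, hx]
  rwa [← heq] at this

/-- On a connected multigraph, divisors of degree zero are torsion modulo linear equivalence. -/
theorem exists_nsmul_eq_principal (hG : G.IsConnected) {D : Divisor G} (hD : degree D = 0) :
    ∃ N : ℕ, N ≠ 0 ∧ ∃ f, N • D = principal f := by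
  obtain ⟨f, hf⟩ := exists_laplacian_eq hG (x := fun u => (D u : ℚ)) (by exact_mod_cast hD)
  -- Clears the denominators of the rational solution.
  set N : ℕ := ∏ v, (f v).den with hN
  have hint : ∀ v, ∃ m : ℤ, (m : ℚ) = N * f v := by
    intro v
    obtain ⟨c, hc⟩ : (f v).den ∣ N := Finset.dvd_prod_of_mem _ (Finset.mem_univ v)
    refine ⟨c * (f v).num, ?_⟩
    rw [hc]
    push_cast
    rw [← Rat.mul_den_eq_num (f v)]
    ring
  choose F hF using hint
  refine ⟨N, Finset.prod_ne_zero_iff.2 fun v _ => (f v).den_ne_zero, F, ?_⟩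
  ext u
  have h1 := laplacian_intCast F u
  have h2 : (fun v => (F v : ℚ)) = (N : ℚ) • f := funext hF
  rw [h2, map_smul, hf] at h1
  simp only [Pi.smul_apply, smul_eq_mul, nsmul_eq_mul] at h1 ⊢
  exact_mod_cast h1

/-- Up to torsion, `D` is the effective divisor `degree D` times a vertex. -/
theorem exists_nsmul_linearSystem_nonempty (hG : G.IsConnected) {D : Divisor G}
    (hD : 0 ≤ degree D) : ∃ N : ℕ, N ≠ 0 ∧ ∀ m : ℕ, (linearSystem ((m * N) • D)).Nonempty := by
  classical
  obtain ⟨w, hw⟩ := hG.1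
  set P : Divisor G := Pi.single ⟨w, hw⟩ (degree D) with hP
  obtain ⟨N, hN, f, hf⟩ := exists_nsmul_eq_principal hG (D := D - P)
    (by rw [degree_sub, hP, degree_single, sub_self])
  refine ⟨N, hN, fun m => ⟨(m * N) • P, fun u => ?_, ?_⟩⟩
  · exact nsmul_nonneg (isEffective_single (G := G) ⟨w, hw⟩ hD u) _
  · refine LinEquiv.symm (linEquiv_iff.2 ?_)
    rw [← smul_sub, mul_smul]
    exact nsmul_mem (AddMonoidHom.mem_range.2 ⟨f, hf.symm⟩) m

/-- On a connected multigraph, all divisors of large degree have a non-empty linear system. -/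
theorem exists_forall_linearSystem_nonempty (hG : G.IsConnected) :
    ∃ C : ℤ, ∀ D : Divisor G, C ≤ degree D → (linearSystem D).Nonempty := by
  classical
  obtain ⟨w, hw⟩ := hG.1
  have htors : ∀ v : V(G), ∃ N : ℕ, N ≠ 0 ∧ ∃ f,
      N • (Pi.single v 1 - Pi.single ⟨w, hw⟩ 1 : Divisor G) = principal f := fun v =>
    exists_nsmul_eq_principal hG (by rw [degree_sub, degree_single, degree_single, sub_self])
  choose N hN f hf using htors
  refine ⟨∑ v, (N v : ℤ), fun D hD => ?_⟩
  have hNpos : ∀ v, 0 < (N v : ℤ) := fun v => by exact_mod_cast Nat.pos_of_ne_zero (hN v)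
  -- Subtracting `Q` reduces each coefficient away from `w` modulo `N v` and moves the excess to
  -- `w`. The degree bound then makes the coefficient at `w` positive.
  set Q : Divisor G := ∑ v, (D v / N v) • N v • (Pi.single v 1 - Pi.single ⟨w, hw⟩ 1) with hQ
  have hQp : Q ∈ (principalHom (G := G)).range :=
    sum_mem fun v _ => zsmul_mem (AddMonoidHom.mem_range.2 ⟨f v, (hf v).symm⟩) _
  have hl : LinEquiv (D - Q) D := by
    rw [linEquiv_iff]
    simpa using neg_mem hQp
  have hval : ∀ v : V(G), v ≠ ⟨w, hw⟩ → (D - Q) v = D v % N v := by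
    intro v hv
    have : Q v = D v / N v * N v := by
      rw [hQ, Finset.sum_apply, Finset.sum_eq_single v]
      · simp [hv]
      · intro u _ huv
        simp [hv, huv.symm]
      · simp
    rw [Pi.sub_apply, this, Int.emod_def]
    ring
  have hoff : ∀ v : V(G), v ≠ ⟨w, hw⟩ → 0 ≤ (D - Q) v := fun v hv => by
    rw [hval v hv]
    exact Int.emod_nonneg _ (hNpos v).ne'
  refine ⟨D - Q, fun u => ?_, hl⟩
  rcases eq_or_ne u ⟨w, hw⟩ with rfl | hu
  · have h1 := hl.degree_eq
    rw [degree, ← Finset.add_sum_erase _ _ (Finset.mem_univ (⟨w, hw⟩ : V(G)))] at h1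
    rw [← Finset.add_sum_erase _ _ (Finset.mem_univ (⟨w, hw⟩ : V(G)))] at hD
    have h2 : ∑ v ∈ Finset.univ.erase (⟨w, hw⟩ : V(G)), (D - Q) v
        ≤ ∑ v ∈ Finset.univ.erase (⟨w, hw⟩ : V(G)), (N v : ℤ) :=
      Finset.sum_le_sum fun v hv => by
        rw [hval v (Finset.ne_of_mem_erase hv)]
        exact (Int.emod_lt_of_pos _ (hNpos v)).le
    linarith [hNpos ⟨w, hw⟩]
  · exact hoff u hu

end Torsion

end Graph.Divisor

/-! ### The Poincaré series and its domain of convergence. -/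

namespace Graph.Divisor

variable {α β : Type*} {G : Graph α β} [Fintype V(G)] [Fintype E(G)]

theorem coeff_poincareSeries {k : ℕ} (D : Fin k → Divisor G) (n : Fin k →₀ ℕ) :
    MvPowerSeries.coeff n (poincareSeries D) = rank (n.sum fun i m => m • D i) + 1 := by
  rw [Finsupp.sum_fintype _ (fun i m => m • D i) fun i => zero_nsmul _]
  rfl

theorem poincareSeries_mem_rationalSeries (hG : G.IsConnected) {k : ℕ} (D : Fin k → Divisor G) :
    poincareSeries D ∈ MvPowerSeries.rationalSeries degreeHom D := by
  classical
  obtain ⟨C, hC⟩ := exists_forall_linearSystem_nonempty hG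
  obtain ⟨C', γ, hγ⟩ := exists_rank_eq_degree_sub hG.1 hC
  have heq : poincareSeries D
      = MvPowerSeries.orbitSeries (fun x => rank x + 1) D Finset.univ 0 := by
    ext n
    rw [MvPowerSeries.coeff_orbitSeries, if_pos (Finset.subset_univ _), coeff_poincareSeries,
      zero_add]
  rw [heq]
  -- The shift from `γ` to `γ - 1` absorbs the `+ 1` in `rank + 1`.
  refine MvPowerSeries.orbitSeries_mem_rationalSeries D (C := C') (γ := γ - 1) (fun x hx => ?_)
    (fun x hx => ?_) (fun y hy => ?_) _ _
  · rw [rank_of_degree_neg hx, neg_add_cancel]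
  · rw [hγ x hx, degreeHom_apply]
    ring
  · obtain ⟨N, hN, f, hf⟩ := exists_nsmul_eq_principal hG hy
    refine ⟨N, hN, fun x => ?_⟩
    rw [rank_congr (D := x + N • y) (D' := x) ⟨f, by rw [add_sub_cancel_left, hf]⟩]

theorem norm_prod_pow_lt_one (hG : G.IsConnected) {k : ℕ} {D : Fin k → Divisor G}
    {z : Fin k → ℂ} (hz : Summable fun n : Fin k →₀ ℕ => ‖poincareTerm D z n‖)
    {b : Fin k →₀ ℕ} (hb : b ≠ 0) (hdeg : 0 ≤ degree (b.sum fun i m => m • D i)) :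
    ‖∏ i, z i ^ b i‖ < 1 := by
  obtain ⟨N, hN, hne⟩ := exists_nsmul_linearSystem_nonempty hG hdeg
  by_contra! hge
  have hinj : Function.Injective fun m : ℕ => (m * N) • b := by
    intro m m' h
    obtain ⟨i, hi⟩ := DFunLike.ne_iff.1 hb
    have h1 := DFunLike.congr_fun h i
    simp only [Finsupp.smul_apply, smul_eq_mul] at h1
    exact Nat.eq_of_mul_eq_mul_right (Nat.pos_of_ne_zero hN)
      (Nat.eq_of_mul_eq_mul_right (Nat.pos_of_ne_zero hi) h1)
  -- The terms along the multiples `(m * N) • b` tend to zero, yet each would have norm at least `1`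
  -- if `1 ≤ ‖z ^ b‖`.
  have ht := (hz.comp_injective hinj).tendsto_atTop_zero
  refine absurd (ge_of_tendsto' ht (b := 1) fun m => ?_) (by norm_num)
  have hcoeff : (1 : ℝ) ≤ ‖((MvPowerSeries.coeff ((m * N) • b) (poincareSeries D) : ℤ) : ℂ)‖ := by
    rw [coeff_poincareSeries, MvPowerSeries.sum_smul_smul, Complex.norm_intCast]
    have := zero_le_rank hG.1 (hne m)
    exact_mod_cast (le_abs_self _).trans' (by omega)
  have hprod : ∏ i, z i ^ ((m * N) • b) i = (∏ i, z i ^ b i) ^ (m * N) := by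
    rw [← Finset.prod_pow]
    refine Finset.prod_congr rfl fun i _ => ?_
    rw [← pow_mul, Finsupp.smul_apply, smul_eq_mul, mul_comm]
  rw [Function.comp_apply, poincareTerm, norm_mul, hprod, norm_pow]
  exact one_le_mul_of_one_le_of_one_le hcoeff (one_le_pow₀ hge)

theorem aeval_ne_zero_of_mem_denominators (hG : G.IsConnected) {k : ℕ} {D : Fin k → Divisor G}
    {z : Fin k → ℂ} (hz : Summable fun n : Fin k →₀ ℕ => ‖poincareTerm D z n‖)
    {g : MvPolynomial (Fin k) ℤ} (hg : g ∈ MvPowerSeries.denominators degreeHom D) :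
    MvPolynomial.aeval z g ≠ 0 := by
  induction hg using Submonoid.closure_induction with
  | mem p hp =>
    obtain ⟨b, hb, hdeg, rfl⟩ := hp
    have hlt := norm_prod_pow_lt_one hG hz hb hdeg
    rw [map_sub, map_one, MvPolynomial.aeval_monomial, map_one, one_mul,
      Finsupp.prod_fintype _ _ fun i => pow_zero _, sub_ne_zero]
    intro h
    rw [← h, norm_one] at hlt
    exact lt_irrefl _ hlt
  | one => simp
  | mul p q _ _ hp hq =>
    rw [map_mul]
    exact mul_ne_zero hp hq

end Graph.Divisor

theorem mainTheorem1 {α β : Type*} (G : Graph α β) [Fintype V(G)] [Fintype E(G)]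
    (hG : G.IsConnected) {k : ℕ} (D : Fin k → G.Divisor) :
    ∃ f g : MvPolynomial (Fin k) ℤ, g ≠ 0 ∧
      (g : MvPowerSeries (Fin k) ℤ) * Graph.Divisor.poincareSeries D
        = (f : MvPowerSeries (Fin k) ℤ) ∧
      ∀ z : Fin k → ℂ, Summable (fun n : Fin k →₀ ℕ => ‖Graph.Divisor.poincareTerm D z n‖) →
        MvPolynomial.aeval z g ≠ 0 ∧
        HasSum (fun n : Fin k →₀ ℕ => Graph.Divisor.poincareTerm D z n)
          (MvPolynomial.aeval z f / MvPolynomial.aeval z g) := by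
  obtain ⟨g, hg, f, hf⟩ := Graph.Divisor.poincareSeries_mem_rationalSeries hG D
  refine ⟨f, g, MvPowerSeries.ne_zero_of_mem_denominators hg, hf, fun z hz => ?_⟩
  have hgz := Graph.Divisor.aeval_ne_zero_of_mem_denominators hG hz hg
  obtain ⟨S, hS⟩ := hz.of_norm
  have h1 := MvPowerSeries.hasSum_coe_mul hS g
  rw [hf] at h1
  have h2 := h1.unique (MvPowerSeries.hasSum_coe f z)
  refine ⟨hgz, ?_⟩
  rwa [← h2, mul_div_cancel_left₀ S hgz]
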